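/- Let $M$ be a (second countable, Hausdorff) topological manifold, possibly with boundary, with a foliation $\mathcal F$ of class $C^0$ of any dimension $p\ge 0$ and codimension $q\ge 0$, the boundary of $M$ (if non-empty) being a union of leaves. (In particular, $\mathcal F$ may be a $C^r$-foliation for any $r \geq 0$.) The leaf topology is the topology on $M$ generated by the open subsets of the plaques of the foliation charts, and the leaves are its connected components; a leaf is called non-compact if it is not compact in its leaf topology, and proper if its leaf topology coincides with the topology induced from $M$. For a union $A\subset M$ of leaves, a leaf $L\subset A$ is called isolated with respect to $A$ if $L$ is an open subset of the subspace $Cl(A)$ of $M$, and $I(A)$ denotes the union of all leaves that are isolated with respect to $A$. Finite sets are considered to be countable. Let $A$ be a union of non-compact leaves of $\mathcal F$. Then at least one of the following holds: (i) $Cl(A)$ contains uncountably many non-compact leaves, or (ii) $A\subset Cl(I(A))$. Moreover, for every leaf $L$ of $\mathcal F$ that is not proper, the closure $Cl(L)$ contains uncountably many non-compact leaves. -/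

import Mathlib

open Set

/-- The transverse model `{y ∈ ℝ^q : 0 ≤ ℓ y}`, for a linear functional `ℓ` on `ℝ^q`: it is all
of `ℝ^q` if `ℓ = 0`, and a closed half-space if `ℓ ≠ 0`. -/
abbrev TransverseModel {q : ℕ} (ℓ : EuclideanSpace ℝ (Fin q) →L[ℝ] ℝ) : Type :=
  {y : EuclideanSpace ℝ (Fin q) // 0 ≤ ℓ y}

/-- A (topological) foliation of dimension `p` and codimension `q` of `M`, given by an atlas of
foliation charts. With `ℓ = 0` the charts are modelled on `ℝ^p × ℝ^q`, so that `M` is a manifold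
without boundary; with `ℓ ≠ 0` they are modelled on `ℝ^p × (closed half-space of ℝ^q)`, so that
`M` is a manifold with (possibly empty) boundary and the boundary is a union of leaves. -/
structure Foliation (p : ℕ) {q : ℕ} (ℓ : EuclideanSpace ℝ (Fin q) →L[ℝ] ℝ)
    (M : Type*) [TopologicalSpace M] where
  /-- the foliation charts -/
  atlas : Set (OpenPartialHomeomorph M (EuclideanSpace ℝ (Fin p) × TransverseModel ℓ))
  /-- the charts cover `M` -/
  covers : ∀ x : M, ∃ e ∈ atlas, x ∈ e.source
  /-- locally, the transverse coordinate of a chart is a function of the transverse coordinate of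
  any other chart, i.e. changes of charts are locally of the form `(u, y) ↦ (h(u, y), γ(y))` -/
  compatible : ∀ e ∈ atlas, ∀ e' ∈ atlas, ∀ x ∈ e.source ∩ e'.source,
    ∃ W : Set M, IsOpen W ∧ x ∈ W ∧ W ⊆ e.source ∩ e'.source ∧
      ∃ γ : TransverseModel ℓ → TransverseModel ℓ, ∀ w ∈ W, (e' w).2 = γ (e w).2

namespace Foliation

variable {p q : ℕ} {ℓ : EuclideanSpace ℝ (Fin q) →L[ℝ] ℝ} {M : Type*} [TopologicalSpace M]

/-- The leaf topology on `M`, generated by the open subsets of the plaques of all charts. -/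
@[reducible] def leafTopology (F : Foliation p ℓ M) : TopologicalSpace M :=
  TopologicalSpace.generateFrom
    {s | ∃ e ∈ F.atlas, ∃ V : Set (EuclideanSpace ℝ (Fin p)), IsOpen V ∧
      ∃ t : TransverseModel ℓ, s = {x | x ∈ e.source ∧ (e x).1 ∈ V ∧ (e x).2 = t}}

/-- The leaf through `x`: its connected component in the leaf topology. -/
def leaf (F : Foliation p ℓ M) (x : M) : Set M :=
  @connectedComponent M F.leafTopology x

/-- `L` is a leaf of the foliation. -/
def IsLeaf (F : Foliation p ℓ M) (L : Set M) : Prop :=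
  ∃ x : M, L = F.leaf x

/-- `L` is a non-compact leaf, i.e. not compact in its leaf topology. -/
def IsNoncompactLeaf (F : Foliation p ℓ M) (L : Set M) : Prop :=
  F.IsLeaf L ∧ ¬ @IsCompact M F.leafTopology L

/-- `L` is a proper leaf: its leaf topology coincides with the topology induced from `M`. -/
def IsProperLeaf (F : Foliation p ℓ M) (L : Set M) : Prop :=
  F.IsLeaf L ∧
    TopologicalSpace.induced (Subtype.val : L → M) F.leafTopology =
      (instTopologicalSpaceSubtype : TopologicalSpace L)

/-- `L` is a leaf contained in `A` that is isolated with respect to `A`: it is an open subset of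
the subspace `closure A` of `M`. -/
def IsIsolatedLeaf (F : Foliation p ℓ M) (A L : Set M) : Prop :=
  F.IsLeaf L ∧ L ⊆ A ∧ ∃ U : Set M, IsOpen U ∧ L = U ∩ closure A

/-- `I(A)`: the union of the leaves that are isolated with respect to `A`. -/
def isolatedPart (F : Foliation p ℓ M) (A : Set M) : Set M :=
  ⋃₀ {L | F.IsIsolatedLeaf A L}

end Foliation

/-! The theorem is a Baire category argument in the locally compact Hausdorff space `closure A`.
Suppose it contains only countably many non-compact leaves. Fix countably many foliated boxes
covering `M`. Then `closure A` is covered by countably many closed sets of two kinds.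

Non-compact leaves: each is covered by countably many compact plaques
(`exists_countable_cover_leaf`). Compact leaves: each lies in some `compactPart` for a finite tuple
of boxes (`exists_mem_compactPart`). This set is closed (`isClosed_compactPart`) and meets only
compact leaves (`isCompact_leaf_of_mem_compactPart`), however many of them there are.

By Baire, every open set meeting `A` contains a point of `A` near which `closure A` lies in one of
these sets. The second kind is excluded, since the leaves in `A` are non-compact. So near that point
`closure A` lies in a single plaque, and sliding along the leaf (`Saturated.nhdsWithin_le`) shows
that the whole leaf is isolated. For the last claim take `A = L`: a compact leaf is proper anyway,
and for a non-compact one the same local conclusion gives properness. -/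

open Filter Topology Metric

namespace Foliation

variable {p q : ℕ} {ℓ : EuclideanSpace ℝ (Fin q) →L[ℝ] ℝ} {M : Type*} [TopologicalSpace M]

/-! ### Leaf topology and plaques -/

/-- The leaf topology is finer than the manifold topology. -/
theorem leafTopology_le (F : Foliation p ℓ M) : F.leafTopology ≤ ‹TopologicalSpace M› := by
  intro O hO
  rw [@isOpen_iff_mem_nhds M F.leafTopology]
  intro x hx
  obtain ⟨e, he, hxe⟩ := F.covers x
  have h1 : e.symm ⁻¹' O ∈ 𝓝 (e x) := by
    apply (e.continuousAt_symm (e.map_source hxe)).preimage_mem_nhds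
    rw [e.left_inv hxe]
    exact hO.mem_nhds hx
  obtain ⟨V, T, hV, hxV, hT, hxT, hVT⟩ := mem_nhds_prod_iff'.1 h1
  have h2 : IsOpen[F.leafTopology] {y | y ∈ e.source ∧ (e y).1 ∈ V ∧ (e y).2 = (e x).2} :=
    TopologicalSpace.isOpen_generateFrom_of_mem ⟨e, he, V, hV, _, rfl⟩
  refine Filter.mem_of_superset (@IsOpen.mem_nhds M F.leafTopology _ _ h2 ⟨hxe, hxV, rfl⟩) ?_
  rintro y ⟨hy, hyV, hyT⟩
  have := @hVT (e y) ⟨hyV, by rw [hyT]; exact hxT⟩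
  rwa [mem_preimage, e.left_inv hy] at this

/-- Parametrizations of plaques are continuous for the leaf topology. -/
theorem continuousOn_plaque (F : Foliation p ℓ M)
    {e : OpenPartialHomeomorph M (EuclideanSpace ℝ (Fin p) × TransverseModel ℓ)}
    (he : e ∈ F.atlas) (t : TransverseModel ℓ) :
    @ContinuousOn _ M _ F.leafTopology (fun u => e.symm (u, t)) {u | (u, t) ∈ e.target} := by
  intro u hu
  refine @ContinuousAt.continuousWithinAt _ M _ F.leafTopology _ _ _ ?_
  refine TopologicalSpace.tendsto_nhds_generateFrom_iff.2 ?_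
  rintro s ⟨e', he', V, hV, t', rfl⟩ ⟨h1, h2, h3⟩
  have hc : ContinuousAt (fun u => e.symm (u, t)) u :=
    (e.continuousAt_symm hu).comp (f := fun u => (u, t)) (by fun_prop)
  -- On `W` the transverse coordinate of `e'` is a function of that of `e`, which is constantly `t`
  -- along the plaque.
  obtain ⟨W, hW, hxW, hWs, γ, hγ⟩ :=
    F.compatible e he e' he' (e.symm (u, t)) ⟨e.map_target hu, h1⟩
  have hc' : ContinuousAt (fun u => (e' (e.symm (u, t))).1) u :=
    continuous_fst.continuousAt.comp (f := fun u => e' (e.symm (u, t)))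
      ((e'.continuousAt h1).comp (f := fun u => e.symm (u, t)) hc)
  have ht : ContinuousAt (fun v : EuclideanSpace ℝ (Fin p) => (v, t)) u := by fun_prop
  filter_upwards [hc.preimage_mem_nhds (hW.mem_nhds hxW), hc'.preimage_mem_nhds (hV.mem_nhds h2),
    ht.preimage_mem_nhds (e.open_target.mem_nhds hu)] with v hv1 hv2 hv3
  refine ⟨(hWs hv1).2, hv2, ?_⟩
  rw [hγ _ hv1, e.right_inv hv3, ← h3, hγ _ hxW, e.right_inv hu]

/-! ### Foliated boxes -/

/-- A foliated box: a chart together with a ball of radius `2 * r` and a compact set `K` of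
transverse parameters such that the product of the two lies in the image of the chart. -/
structure Box (F : Foliation p ℓ M) where
  /-- the chart -/
  e : OpenPartialHomeomorph M (EuclideanSpace ℝ (Fin p) × TransverseModel ℓ)
  mem_atlas : e ∈ F.atlas
  /-- the centre of the plaques -/
  c : EuclideanSpace ℝ (Fin p)
  /-- half of the radius of the plaques -/
  r : ℝ
  /-- the transverse parameters -/
  K : Set (TransverseModel ℓ)
  isCompact_K : IsCompact K
  r_pos : 0 < r
  subset_target : ball c (2 * r) ×ˢ K ⊆ e.target

namespace Box

variable {F : Foliation p ℓ M}

/-- The parametrization of the plaque with transverse parameter `t`. -/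
def slice (B : F.Box) (t : TransverseModel ℓ) (u : EuclideanSpace ℝ (Fin p)) : M := B.e.symm (u, t)

/-- The domain of the plaques of a box. -/
def dom (B : F.Box) : Set (EuclideanSpace ℝ (Fin p)) := ball B.c (2 * B.r)

/-- The closed ball of half the radius. -/
def core (B : F.Box) : Set (EuclideanSpace ℝ (Fin p)) := closedBall B.c B.r

/-- The open box of half the size. -/
def inner (B : F.Box) : Set M :=
  {x | x ∈ B.e.source ∧ (B.e x).1 ∈ ball B.c B.r ∧ (B.e x).2 ∈ interior B.K}

theorem isOpen_dom (B : F.Box) : IsOpen B.dom := isOpen_ball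

theorem isCompact_core (B : F.Box) : IsCompact B.core := isCompact_closedBall _ _

theorem core_subset_dom (B : F.Box) : B.core ⊆ B.dom :=
  closedBall_subset_ball (by linarith [B.r_pos])

theorem ball_subset_core (B : F.Box) : ball B.c B.r ⊆ B.core := ball_subset_closedBall

theorem mem_target (B : F.Box) {t u} (ht : t ∈ B.K) (hu : u ∈ B.dom) : (u, t) ∈ B.e.target :=
  B.subset_target ⟨hu, ht⟩

theorem e_slice (B : F.Box) {t u} (ht : t ∈ B.K) (hu : u ∈ B.dom) : B.e (B.slice t u) = (u, t) :=
  B.e.right_inv (B.mem_target ht hu)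

theorem slice_mem_source (B : F.Box) {t u} (ht : t ∈ B.K) (hu : u ∈ B.dom) :
    B.slice t u ∈ B.e.source :=
  B.e.map_target (B.mem_target ht hu)

theorem slice_e (B : F.Box) {x : M} (hx : x ∈ B.e.source) : B.slice (B.e x).2 (B.e x).1 = x :=
  B.e.left_inv hx

theorem continuousOn_uncurry_slice (B : F.Box) :
    ContinuousOn (fun z : TransverseModel ℓ × EuclideanSpace ℝ (Fin p) => B.slice z.1 z.2)
      (B.K ×ˢ B.dom) :=
  B.e.continuousOn_symm.comp (f := fun z : TransverseModel ℓ × EuclideanSpace ℝ (Fin p) =>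
    (z.2, z.1)) (by fun_prop) fun _ hz => B.mem_target hz.1 hz.2

theorem continuousOn_slice (B : F.Box) {t} (ht : t ∈ B.K) :
    @ContinuousOn _ M _ F.leafTopology (B.slice t) B.dom :=
  @ContinuousOn.mono _ _ _ F.leafTopology _ _ _ (F.continuousOn_plaque B.mem_atlas t)
    fun _ hu => B.mem_target ht hu

theorem isOpen_image_slice (B : F.Box) {t} (ht : t ∈ B.K) {V} (hV : IsOpen V) (hVd : V ⊆ B.dom) :
    IsOpen[F.leafTopology] (B.slice t '' V) := by
  refine TopologicalSpace.isOpen_generateFrom_of_mem ⟨B.e, B.mem_atlas, V, hV, t, ?_⟩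
  ext x
  constructor
  · rintro ⟨u, hu, rfl⟩
    exact ⟨B.slice_mem_source ht (hVd hu), by rwa [B.e_slice ht (hVd hu)],
      by rw [B.e_slice ht (hVd hu)]⟩
  · rintro ⟨h1, h2, rfl⟩
    exact ⟨_, h2, B.slice_e h1⟩

theorem slice_mem_leaf (B : F.Box) {t u v} (ht : t ∈ B.K) (hu : u ∈ B.dom) (hv : v ∈ B.dom) :
    B.slice t v ∈ F.leaf (B.slice t u) := by
  have h : @IsPreconnected M F.leafTopology (B.slice t '' B.dom) :=
    @IsPreconnected.image _ M _ F.leafTopology _ (convex_ball _ _).isPreconnected _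
      (B.continuousOn_slice ht)
  exact (@IsPreconnected.subset_connectedComponent M F.leafTopology _ _ h
    (mem_image_of_mem (B.slice t) hu)) (mem_image_of_mem (B.slice t) hv)

theorem slice_mem_leaf' (B : F.Box) {w : M} {v} (h1 : w ∈ B.e.source) (h2 : (B.e w).1 ∈ B.dom)
    (h3 : (B.e w).2 ∈ B.K) (hv : v ∈ B.dom) : B.slice (B.e w).2 v ∈ F.leaf w := by
  have := B.slice_mem_leaf h3 h2 hv
  rwa [B.slice_e h1] at this

theorem preimage_slice_mem_nhds (B : F.Box) {t u} (ht : t ∈ B.K) (hu : u ∈ B.dom) {N : Set M}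
    (hN : N ∈ @nhds M F.leafTopology (B.slice t u)) : B.slice t ⁻¹' N ∈ 𝓝 u :=
  (@ContinuousOn.continuousAt _ M _ F.leafTopology _ _ _ (B.continuousOn_slice ht)
    (B.isOpen_dom.mem_nhds hu)) hN

theorem tendsto_fst (B : F.Box) {t u} (ht : t ∈ B.K) (hu : u ∈ B.dom) :
    Tendsto (fun w => (B.e w).1) (𝓝 (B.slice t u)) (𝓝 u) := by
  have := (continuous_fst.continuousAt.comp
    (B.e.continuousAt (B.slice_mem_source ht hu))).tendsto
  rwa [Function.comp_apply, B.e_slice ht hu] at this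

theorem isOpen_inner (B : F.Box) : IsOpen B.inner := by
  have := B.e.isOpen_inter_preimage
    ((isOpen_ball (x := B.c) (ε := B.r)).prod (isOpen_interior (s := B.K)))
  exact this

theorem exists_slice_of_mem_inner (B : F.Box) {x : M} (hx : x ∈ B.inner) :
    ∃ t ∈ interior B.K, ∃ u ∈ ball B.c B.r, B.slice t u = x :=
  ⟨_, hx.2.2, _, hx.2.1, B.slice_e hx.1⟩

theorem eventually_mem (B : F.Box) {t v} (ht : t ∈ interior B.K) (hv : v ∈ B.dom) :
    ∀ᶠ w in 𝓝 (B.slice t v), w ∈ B.e.source ∧ (B.e w).1 ∈ B.dom ∧ (B.e w).2 ∈ B.K := by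
  have ht' := interior_subset ht
  have hs := B.slice_mem_source ht' hv
  have h := (B.e.continuousAt hs).preimage_mem_nhds
    ((B.isOpen_dom.prod isOpen_interior).mem_nhds (by
      rw [B.e_slice ht' hv]; exact ⟨hv, ht⟩))
  filter_upwards [B.e.open_source.mem_nhds hs, h] with w h1 h2
  exact ⟨h1, h2.1, interior_subset h2.2⟩

/-- Sliding `w` inside its own plaque to the plaque coordinate `u` is continuous for the topology of
`M` and does not change the leaf. Local properties of saturated sets spread along plaques in this
way. -/
theorem tendsto_transport (B : F.Box) {t u v} (ht : t ∈ B.K) (hu : u ∈ B.dom)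
    (hv : v ∈ B.dom) :
    Tendsto (fun w => B.slice (B.e w).2 u) (𝓝 (B.slice t v)) (𝓝 (B.slice t u)) := by
  have hs := B.slice_mem_source ht hv
  have h1 : ContinuousAt (fun w => (u, (B.e w).2)) (B.slice t v) :=
    continuousAt_const.prodMk (continuous_snd.continuousAt.comp (B.e.continuousAt hs))
  have h2 : Tendsto B.e.symm (𝓝 (u, t)) (𝓝 (B.slice t u)) :=
    B.e.continuousAt_symm (B.mem_target ht hu)
  have h3 : Tendsto (fun w => (u, (B.e w).2)) (𝓝 (B.slice t v)) (𝓝 (u, t)) := by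
    have := h1.tendsto
    rwa [B.e_slice ht hv] at this
  exact h2.comp h3

end Box

/-! ### Leaves, saturated sets and transport along leaves -/

variable (F : Foliation p ℓ M)

theorem mem_leaf_self (x : M) : x ∈ F.leaf x := by
  exact @mem_connectedComponent M F.leafTopology x

variable {F} in
theorem leaf_eq_of_mem {x y : M} (h : y ∈ F.leaf x) : F.leaf y = F.leaf x := by
  exact (@connectedComponent_eq M F.leafTopology _ _ h).symm

theorem locallyCompactSpace_transverseModel (ℓ : EuclideanSpace ℝ (Fin q) →L[ℝ] ℝ) :
    LocallyCompactSpace (TransverseModel ℓ) := by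
  have : IsClosed {y : EuclideanSpace ℝ (Fin q) | 0 ≤ ℓ y} :=
    isClosed_le continuous_const ℓ.continuous
  exact this.isClosedEmbedding_subtypeVal.locallyCompactSpace

theorem exists_mem_inner (x : M) : ∃ B : F.Box, x ∈ B.inner := by
  obtain ⟨e, he, hx⟩ := F.covers x
  have := locallyCompactSpace_transverseModel ℓ
  obtain ⟨V, T, hV, hxV, hT, hxT, hVT⟩ :=
    mem_nhds_prod_iff'.1 (e.open_target.mem_nhds (e.map_source hx))
  obtain ⟨r, hr, hrV⟩ := Metric.isOpen_iff.1 hV _ hxV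
  obtain ⟨K, hK, hxK, hKT⟩ := exists_compact_subset hT hxT
  refine ⟨⟨e, he, (e x).1, r / 2, K, hK, by linarith, ?_⟩, hx, ?_, hxK⟩
  · rw [mul_div_cancel₀ _ two_ne_zero]
    exact (prod_mono hrV hKT).trans hVT
  · exact mem_ball_self (by linarith)

variable {F} in
/-- A property that spreads along plaques spreads along leaves. -/
theorem leaf_induction {P : M → Prop}
    (hP : ∀ (B : F.Box), ∀ t ∈ interior B.K, ∀ u ∈ B.dom, ∀ v ∈ B.dom,
      P (B.slice t u) → P (B.slice t v)) {x y : M} (hy : y ∈ F.leaf x) (hx : P x) : P y := by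
  have key : ∀ Q : M → Prop, (∀ (B : F.Box), ∀ t ∈ interior B.K, ∀ u ∈ B.dom, ∀ v ∈ B.dom,
      Q (B.slice t u) → Q (B.slice t v)) → IsOpen[F.leafTopology] {z | Q z} := by
    intro Q hQ
    rw [@isOpen_iff_mem_nhds M F.leafTopology]
    intro z hz
    obtain ⟨B, hB⟩ := F.exists_mem_inner z
    obtain ⟨t, ht, u, hu, rfl⟩ := B.exists_slice_of_mem_inner hB
    have hu' := B.core_subset_dom (B.ball_subset_core hu)
    refine Filter.mem_of_superset (@IsOpen.mem_nhds M F.leafTopology _ _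
      (B.isOpen_image_slice (interior_subset ht) B.isOpen_dom subset_rfl)
      (mem_image_of_mem _ hu')) ?_
    rintro _ ⟨v, hv, rfl⟩
    exact hQ B t ht u hu' v hv hz
  have h1 := key P hP
  -- `hP` is symmetric in `u` and `v`, so the negation spreads along plaques too.
  have h2 := key (fun z => ¬ P z) fun B t ht u hu v hv h h' => h (hP B t ht v hv u hu h')
  have h3 : @IsClopen M F.leafTopology {z | P z} := ⟨@IsClosed.mk M F.leafTopology _ h2, h1⟩
  exact (@IsClopen.connectedComponent_subset M F.leafTopology _ _ h3 hx) hy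

theorem isClopen_leaf (x : M) : @IsClopen M F.leafTopology (F.leaf x) := by
  refine ⟨@isClosed_connectedComponent M F.leafTopology x, ?_⟩
  rw [@isOpen_iff_mem_nhds M F.leafTopology]
  intro z hz
  obtain ⟨B, hB⟩ := F.exists_mem_inner z
  obtain ⟨t, ht, u, hu, rfl⟩ := B.exists_slice_of_mem_inner hB
  have hu' := B.core_subset_dom (B.ball_subset_core hu)
  refine Filter.mem_of_superset (@IsOpen.mem_nhds M F.leafTopology _ _
    (B.isOpen_image_slice (interior_subset ht) B.isOpen_dom subset_rfl)
    (mem_image_of_mem _ hu')) ?_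
  rintro _ ⟨v, hv, rfl⟩
  rw [← leaf_eq_of_mem hz]
  exact B.slice_mem_leaf (interior_subset ht) hu' hv

/-- `A` is a union of leaves. -/
def Saturated (A : Set M) : Prop := ∀ x ∈ A, F.leaf x ⊆ A

variable {F}

/-- Points of `A` approximating one point of a plaque slide within `A` to points approximating any
other. -/
theorem Saturated.closure {A : Set M} (hA : F.Saturated A) : F.Saturated (closure A) := by
  intro x hx y hy
  refine leaf_induction (P := (· ∈ _root_.closure A)) ?_ hy hx
  intro B t ht u hu v hv h
  have ht' := interior_subset ht
  rw [mem_closure_iff_frequently] at h ⊢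
  refine (B.tendsto_transport ht' hv hu).frequently
    ((h.and_eventually (B.eventually_mem ht hu)).mono ?_)
  rintro w ⟨hwA, h1, h2, h3⟩
  apply hA w hwA
  exact B.slice_mem_leaf' h1 h2 h3 hv

/-- Whether a saturated set `X` is near `x` just the leaf through `x`, with the leaf topology,
depends only on the leaf through `x`. -/
theorem Saturated.nhdsWithin_le {X : Set M} (hX : F.Saturated X) {x y : M} (hy : y ∈ F.leaf x)
    (hx : 𝓝[X] x ≤ @nhds M F.leafTopology x) : 𝓝[X] y ≤ @nhds M F.leafTopology y := by
  refine leaf_induction (P := fun x => 𝓝[X] x ≤ @nhds M F.leafTopology x) ?_ hy hx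
  intro B t ht u hu v hv h N hN
  have ht' := interior_subset ht
  -- Points of `X` close to `slice t u` lie on the plaque `t`. Sliding (`htr`) preserves the
  -- transverse coordinate, so points of `X` close to `slice t v` lie on it as well.
  have h1 : B.slice t '' B.dom ∈ 𝓝[X] B.slice t u := h (@IsOpen.mem_nhds M F.leafTopology _ _
      (B.isOpen_image_slice ht' B.isOpen_dom subset_rfl) (mem_image_of_mem _ hu))
  have hloc := nhdsWithin_le_nhds (s := X) (B.eventually_mem ht hv)
  have htr : Tendsto (fun w => B.slice (B.e w).2 u) (𝓝[X] B.slice t v) (𝓝[X] B.slice t u) := by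
    refine tendsto_nhdsWithin_iff.2
      ⟨(B.tendsto_transport ht' hu hv).mono_left nhdsWithin_le_nhds, ?_⟩
    filter_upwards [hloc, self_mem_nhdsWithin] with w ⟨hw1, hw2, hw3⟩ hwX
    apply hX w hwX
    exact B.slice_mem_leaf' hw1 hw2 hw3 hu
  have hN' : B.slice t ⁻¹' N ∈ 𝓝 v := B.preimage_slice_mem_nhds ht' hv hN
  have hc := B.tendsto_fst ht' hv
  filter_upwards [hloc, htr h1, nhdsWithin_le_nhds (hc hN')] with w ⟨hw1, hw2, hw3⟩ hw4 hw5
  obtain ⟨u', hu', he⟩ := hw4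
  have hwt : (B.e w).2 = t := by
    have := congrArg (fun z => (B.e z).2) he
    simp only [B.e_slice ht' hu', B.e_slice hw3 hu] at this
    exact this.symm
  have : B.slice t (B.e w).1 ∈ N := hw5
  rwa [← hwt, B.slice_e hw1] at this

/-- On a single plaque a point is determined by its plaque coordinate, which is continuous on `M`;
so no finer leaf neighbourhoods remain. This turns the outcome of Baire's theorem into a local
statement about leaves. -/
theorem Box.nhdsWithin_le (B : F.Box) {t} (ht : t ∈ B.K) {X O : Set M} (hO : IsOpen O)
    (h : O ∩ X ⊆ B.slice t '' B.core) {y : M} (hyO : y ∈ O) (hyX : y ∈ X) :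
    𝓝[X] y ≤ @nhds M F.leafTopology y := by
  intro N hN
  obtain ⟨u, hu, rfl⟩ := h ⟨hyO, hyX⟩
  have hu' := B.core_subset_dom hu
  have hN' : B.slice t ⁻¹' N ∈ 𝓝 u := B.preimage_slice_mem_nhds ht hu' hN
  have hc := B.tendsto_fst ht hu'
  filter_upwards [self_mem_nhdsWithin, nhdsWithin_le_nhds (hO.mem_nhds hyO),
    nhdsWithin_le_nhds (hc hN')] with w hw1 hw2 hw3
  obtain ⟨v, hv, rfl⟩ := h ⟨hw2, hw1⟩
  rwa [mem_preimage, B.e_slice ht (B.core_subset_dom hv)] at hw3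

end Foliation

/-! ### Countable plaque covers of a leaf -/

/-- The sets reached from `U i₀` by finite chains of successively intersecting members are countably
many. Their union is clopen: a member meeting it already belongs to it. -/
theorem exists_countable_cover_connectedComponent {X ι : Type*} [TopologicalSpace X]
    {U : ι → Set X} (hU : ∀ i, IsOpen (U i)) (hcov : ∀ x, ∃ i, x ∈ U i)
    (hc : ∀ i, {j | (U i ∩ U j).Nonempty}.Countable) (x : X) :
    ∃ J : Set ι, J.Countable ∧ connectedComponent x ⊆ ⋃ j ∈ J, U j := by
  obtain ⟨i₀, hi₀⟩ := hcov x
  let J : ℕ → Set ι := fun n =>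
    Nat.rec {i₀} (fun _ J => ⋃ i ∈ J, {j | (U i ∩ U j).Nonempty}) n
  have hJ : ∀ n, (J n).Countable := by
    intro n
    induction n with
    | zero => exact countable_singleton i₀
    | succ n ih => exact ih.biUnion fun i _ => hc i
  have hmem : ∀ i ∈ ⋃ n, J n, ∀ j, (U i ∩ U j).Nonempty → j ∈ ⋃ n, J n := by
    intro i hi j hij
    obtain ⟨n, hn⟩ := mem_iUnion.1 hi
    exact mem_iUnion.2 ⟨n + 1, mem_biUnion hn hij⟩
  refine ⟨⋃ n, J n, countable_iUnion hJ, IsClopen.connectedComponent_subset ⟨⟨?_⟩, ?_⟩ ?_⟩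
  · rw [isOpen_iff_forall_mem_open]
    intro y hy
    obtain ⟨j, hj⟩ := hcov y
    refine ⟨U j, fun z hz hz' => hy ?_, hU j, hj⟩
    obtain ⟨i, hi, hzi⟩ := mem_iUnion₂.1 hz'
    exact mem_biUnion (hmem i hi j ⟨z, hzi, hz⟩) hj
  · exact isOpen_biUnion fun j _ => hU j
  · exact mem_biUnion (mem_iUnion.2 ⟨0, rfl⟩) hi₀

namespace Foliation

variable {p q : ℕ} {ℓ : EuclideanSpace ℝ (Fin q) →L[ℝ] ℝ} {M : Type*} [TopologicalSpace M]
  {F : Foliation p ℓ M}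

theorem Box.isClosed_image_slice [T2Space M] (B : F.Box) {t} (ht : t ∈ B.K) :
    IsClosed (B.slice t '' B.core) :=
  (B.isCompact_core.image_of_continuousOn
    (B.continuousOn_uncurry_slice.comp (f := fun u => (t, u)) (by fun_prop)
      fun _ hu => ⟨ht, B.core_subset_dom hu⟩)).isClosed

/-- Distinct `t'` cut out disjoint non-empty open subsets of one Euclidean ball, which is separable.
-/
theorem Box.countable_meeting (B B' : F.Box) {t} (ht : t ∈ B.K) :
    {t' | t' ∈ B'.K ∧
      (B.slice t '' ball B.c B.r ∩ B'.slice t' '' ball B'.c B'.r).Nonempty}.Countable := by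
  have hsub := B.ball_subset_core.trans B.core_subset_dom
  have hsub' := B'.ball_subset_core.trans B'.core_subset_dom
  refine Set.PairwiseDisjoint.countable_of_isOpen
    (s := fun t' => ball B.c B.r ∩ B.slice t ⁻¹' (B'.slice t' '' ball B'.c B'.r)) ?_ ?_ ?_
  · rintro t₁ ⟨h₁, -⟩ t₂ ⟨h₂, -⟩ hne
    refine disjoint_left.2 ?_
    rintro u ⟨-, v₁, hv₁, e₁⟩ ⟨-, v₂, hv₂, e₂⟩
    apply hne
    have := congrArg (fun z => (B'.e z).2) (e₁.trans e₂.symm)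
    simpa only [B'.e_slice h₁ (hsub' hv₁), B'.e_slice h₂ (hsub' hv₂)] using this
  · rintro t' ⟨h', -⟩
    refine isOpen_iff_mem_nhds.2 ?_
    rintro u ⟨hu, hu'⟩
    exact inter_mem (isOpen_ball.mem_nhds hu) (B.preimage_slice_mem_nhds ht (hsub hu)
      (@IsOpen.mem_nhds M F.leafTopology _ _ (B'.isOpen_image_slice h' isOpen_ball hsub') hu'))
  · rintro t' ⟨-, _, ⟨u, hu, rfl⟩, h⟩
    exact ⟨u, hu, h⟩

/-- A leaf is covered by countably many compact plaques. -/
theorem exists_countable_cover_leaf {σ : Type*} [Countable σ] (β : σ → F.Box)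
    (hβ : ∀ x, ∃ i, x ∈ (β i).inner) (x : M) :
    ∃ J : Set (σ × TransverseModel ℓ), J.Countable ∧ (∀ j ∈ J, j.2 ∈ (β j.1).K) ∧
      F.leaf x ⊆ ⋃ j ∈ J, (β j.1).slice j.2 '' (β j.1).core := by
  let ι := {j : σ × TransverseModel ℓ // j.2 ∈ (β j.1).K}
  let U : ι → Set M := fun j => (β j.1.1).slice j.1.2 '' ball (β j.1.1).c (β j.1.1).r
  have hU : ∀ i, IsOpen[F.leafTopology] (U i) := fun i =>
    (β i.1.1).isOpen_image_slice i.2 isOpen_ball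
      ((β i.1.1).ball_subset_core.trans (β i.1.1).core_subset_dom)
  have hcov : ∀ y, ∃ i, y ∈ U i := by
    intro y
    obtain ⟨i, hi⟩ := hβ y
    obtain ⟨t, ht, u, hu, rfl⟩ := (β i).exists_slice_of_mem_inner hi
    exact ⟨⟨(i, t), interior_subset ht⟩, mem_image_of_mem _ hu⟩
  have hc : ∀ i, {j | (U i ∩ U j).Nonempty}.Countable := by
    intro i
    have h : (⋃ k : σ, (Prod.mk k) '' {t' | t' ∈ (β k).K ∧ ((β i.1.1).slice i.1.2 ''
        ball (β i.1.1).c (β i.1.1).r ∩ (β k).slice t' '' ball (β k).c (β k).r).Nonempty}).Countable :=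
      countable_iUnion fun k => ((β i.1.1).countable_meeting (β k) i.2).image _
    refine (h.preimage (f := (Subtype.val : ι → _)) Subtype.val_injective).mono ?_
    intro j hj
    exact mem_iUnion.2 ⟨j.1.1, j.1.2, ⟨j.2, hj⟩, rfl⟩
  obtain ⟨J, hJ, hJx⟩ := @exists_countable_cover_connectedComponent M ι F.leafTopology U hU hcov hc x
  refine ⟨Subtype.val '' J, hJ.image _, ?_, ?_⟩
  · rintro _ ⟨j, -, rfl⟩
    exact j.2
  · refine hJx.trans (iUnion₂_subset fun j hj => ?_)
    refine (image_mono (β j.1.1).ball_subset_core).trans ?_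
    exact subset_biUnion_of_mem (u := fun j : σ × TransverseModel ℓ =>
      (β j.1).slice j.2 '' (β j.1).core) (mem_image_of_mem _ hj)

/-! ### Closed families of compact leaves -/

section CompactLeaves

variable {κ : Type*} (β : κ → F.Box)

/-- The union of the compact plaques of the boxes `β` with transverse parameters `t`. -/
def plaqueUnion (t : κ → TransverseModel ℓ) : Set M := ⋃ j, (β j).slice (t j) '' (β j).core

/-- The transverse parameters for which the larger plaques are covered by the compact ones. -/
def admissible : Set (κ → TransverseModel ℓ) :=
  {t | (∀ j, t j ∈ (β j).K) ∧ ∀ i, ∀ u ∈ (β i).dom, (β i).slice (t i) u ∈ plaqueUnion β t}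

/-- The union of the leaves that are unions of plaques of `β` with admissible parameters. -/
def compactPart : Set M :=
  ⋃ j, (fun z : (κ → TransverseModel ℓ) × EuclideanSpace ℝ (Fin p) =>
    (β j).slice (z.1 j) z.2) '' (admissible β ×ˢ (β j).core)

theorem continuousOn_slice_apply (j : κ) :
    ContinuousOn (fun z : (κ → TransverseModel ℓ) × EuclideanSpace ℝ (Fin p) =>
      (β j).slice (z.1 j) z.2) (univ.pi (fun j => (β j).K) ×ˢ (β j).dom) :=
  (β j).continuousOn_uncurry_slice.comp
    (f := fun z : (κ → TransverseModel ℓ) × EuclideanSpace ℝ (Fin p) => (z.1 j, z.2))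
    (by fun_prop) fun _ hz => ⟨hz.1 j trivial, hz.2⟩

/-- For fixed `u`, membership of `slice (t i) u` in a compact plaque of the union is a closed
condition on `t`: it is the projection of a compact set of solutions `(t, v)`. Admissibility
intersects these conditions over all `i` and `u`, each being a finite union over `j`. -/
theorem isCompact_admissible [T2Space M] [Finite κ] : IsCompact (admissible β) := by
  have hpi : IsCompact (univ.pi fun j => (β j).K) := isCompact_univ_pi fun j => (β j).isCompact_K
  have hcl : ∀ i j, ∀ u ∈ (β i).dom, IsCompact (Prod.fst ''
      {z : (κ → TransverseModel ℓ) × EuclideanSpace ℝ (Fin p) |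
        z ∈ univ.pi (fun j => (β j).K) ×ˢ (β j).core ∧
          (β i).slice (z.1 i) u = (β j).slice (z.1 j) z.2}) := by
    intro i j u hu
    refine IsCompact.image ?_ continuous_fst
    have h1 : ContinuousOn (fun z : (κ → TransverseModel ℓ) × EuclideanSpace ℝ (Fin p) =>
        (β j).slice (z.1 j) z.2) (univ.pi (fun j => (β j).K) ×ˢ (β j).core) :=
      (continuousOn_slice_apply β j).mono (prod_mono_right (β j).core_subset_dom)
    have h2 : ContinuousOn (fun z : (κ → TransverseModel ℓ) × EuclideanSpace ℝ (Fin p) =>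
        (β i).slice (z.1 i) u) (univ.pi (fun j => (β j).K) ×ˢ (β j).core) :=
      (continuousOn_slice_apply β i).comp
        (f := fun z : (κ → TransverseModel ℓ) × EuclideanSpace ℝ (Fin p) => (z.1, u))
        (by fun_prop) fun _ hz => ⟨hz.1, hu⟩
    have hco := hpi.prod (β j).isCompact_core
    exact hco.of_isClosed_subset ((h2.prodMk h1).preimage_isClosed_of_isClosed hco.isClosed
      isClosed_diagonal) inter_subset_left
  have heq : admissible β = univ.pi (fun j => (β j).K) ∩ ⋂ i, ⋂ u ∈ (β i).dom, ⋃ j, Prod.fst ''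
      {z : (κ → TransverseModel ℓ) × EuclideanSpace ℝ (Fin p) |
        z ∈ univ.pi (fun j => (β j).K) ×ˢ (β j).core ∧
          (β i).slice (z.1 i) u = (β j).slice (z.1 j) z.2} := by
    ext t
    simp only [admissible, plaqueUnion, mem_ofPred_eq, mem_inter_iff, mem_iInter, mem_iUnion,
      mem_image, Prod.exists, mem_prod, mem_univ_pi]
    refine and_congr_right fun ht => forall_congr' fun i => forall₂_congr fun u hu =>
      exists_congr fun j => ?_
    constructor
    · rintro ⟨v, hv, h⟩
      exact ⟨t, v, ⟨⟨ht, hv⟩, h.symm⟩, rfl⟩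
    · rintro ⟨t, v, ⟨⟨-, hv⟩, h⟩, rfl⟩
      exact ⟨v, hv, h.symm⟩
  rw [heq]
  exact hpi.inter_right (isClosed_iInter fun i => isClosed_iInter fun u => isClosed_iInter fun hu =>
    isClosed_iUnion_of_finite fun j => (hcl i j u hu).isClosed)

theorem isClosed_compactPart [T2Space M] [Finite κ] : IsClosed (compactPart β) := by
  refine isClosed_iUnion_of_finite fun j => IsCompact.isClosed ?_
  refine ((isCompact_admissible β).prod (β j).isCompact_core).image_of_continuousOn
    ((continuousOn_slice_apply β j).mono (prod_mono ?_ (β j).core_subset_dom))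
  exact fun t ht i _ => ht.1 i

/-- For admissible `t` the union of compact plaques equals the union of the larger open ones, so it
is compact and clopen in the leaf topology and contains every leaf it meets. -/
theorem isCompact_leaf_of_mem_compactPart [T2Space M] [Finite κ] {x : M}
    (hx : x ∈ compactPart β) : @IsCompact M F.leafTopology (F.leaf x) := by
  obtain ⟨j, ⟨t, u⟩, ⟨⟨htK, ht⟩, hu⟩, rfl⟩ := mem_iUnion.1 hx
  have hcomp : @IsCompact M F.leafTopology (plaqueUnion β t) :=
    @isCompact_iUnion M F.leafTopology _ _ _ fun j =>
      @IsCompact.image_of_continuousOn _ M _ F.leafTopology _ _ (β j).isCompact_core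
        (@ContinuousOn.mono _ M _ F.leafTopology _ _ _ ((β j).continuousOn_slice (htK j))
          (β j).core_subset_dom)
  have hopen : IsOpen[F.leafTopology] (plaqueUnion β t) := by
    have : plaqueUnion β t = ⋃ j, (β j).slice (t j) '' (β j).dom := by
      refine Subset.antisymm (iUnion_mono fun j => image_mono (β j).core_subset_dom)
        (iUnion_subset fun i => ?_)
      rintro _ ⟨v, hv, rfl⟩
      exact ht i v hv
    rw [this]
    exact @isOpen_iUnion M _ F.leafTopology _ fun j =>
      (β j).isOpen_image_slice (htK j) (β j).isOpen_dom subset_rfl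
  have hT2 : @T2Space M F.leafTopology := @T2Space.of_injective_continuous M M F.leafTopology _ _ id
    Function.injective_id (continuous_id_of_le F.leafTopology_le)
  have hclopen : @IsClopen M F.leafTopology (plaqueUnion β t) :=
    ⟨@IsCompact.isClosed M F.leafTopology hT2 _ hcomp, hopen⟩
  refine @IsCompact.of_isClosed_subset M F.leafTopology _ _ hcomp
    (F.isClopen_leaf _).1 (@IsClopen.connectedComponent_subset M F.leafTopology _ _ hclopen ?_)
  exact mem_iUnion.2 ⟨j, mem_image_of_mem _ hu⟩

end CompactLeaves

/-- Finitely many small plaques cover a compact leaf. Their parameters are admissible because the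
larger plaques stay in the leaf. -/
theorem exists_mem_compactPart {σ : Type*} (β : σ → F.Box)
    (hβ : ∀ x, ∃ i, x ∈ (β i).inner) {x : M} (hx : @IsCompact M F.leafTopology (F.leaf x)) :
    ∃ n, ∃ b : Fin n → σ, x ∈ compactPart (β ∘ b) := by
  have hβ' : ∀ y, ∃ i, ∃ t ∈ (β i).K, ∃ u ∈ ball (β i).c (β i).r, (β i).slice t u = y := by
    intro y
    obtain ⟨i, hi⟩ := hβ y
    obtain ⟨t, ht, h⟩ := (β i).exists_slice_of_mem_inner hi
    exact ⟨i, t, interior_subset ht, h⟩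
  choose i t ht u hu hy using hβ'
  have hsub := fun y => (β (i y)).ball_subset_core.trans (β (i y)).core_subset_dom
  obtain ⟨s, hsL, hs⟩ := @IsCompact.elim_nhds_subcover M F.leafTopology _ hx
    (fun y => (β (i y)).slice (t y) '' ball (β (i y)).c (β (i y)).r) fun y _ =>
      @IsOpen.mem_nhds M F.leafTopology _ _
        ((β (i y)).isOpen_image_slice (ht y) isOpen_ball (hsub y)) ⟨u y, hu y, hy y⟩
  let φ := s.equivFin
  let y : Fin s.card → M := fun k => φ.symm k
  have hcov : ∀ z ∈ F.leaf x, ∃ k, ∃ v ∈ (β (i (y k))).core, (β (i (y k))).slice (t (y k)) v = z := by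
    intro z hz
    obtain ⟨w, hw, v, hv, rfl⟩ := mem_iUnion₂.1 (hs hz)
    refine ⟨φ ⟨w, hw⟩, ?_⟩
    simp only [y, Equiv.symm_apply_apply]
    exact ⟨v, (β (i w)).ball_subset_core hv, rfl⟩
  have hadm : (fun k => t (y k)) ∈ admissible (β ∘ fun k => i (y k)) := by
    refine ⟨fun k => ht _, fun k v hv => ?_⟩
    obtain ⟨k', v', hv', h⟩ := hcov ((β (i (y k))).slice (t (y k)) v) (by
      rw [← leaf_eq_of_mem (hsL _ (φ.symm k).2)]
      have := (β (i (y k))).slice_mem_leaf (ht (y k)) (hsub _ (hu (y k))) hv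
      rwa [hy] at this)
    exact mem_iUnion.2 ⟨k', v', hv', h⟩
  refine ⟨s.card, fun k => i (y k), ?_⟩
  obtain ⟨k, v, hv, h⟩ := hcov x (F.mem_leaf_self x)
  exact mem_iUnion.2 ⟨k, (fun k => t (y k), v), ⟨hadm, hv⟩, h⟩

/-! ### The Baire category argument -/

theorem locallyCompactSpace (F : Foliation p ℓ M) : LocallyCompactSpace M := by
  have := locallyCompactSpace_transverseModel ℓ
  choose e he hx using F.covers
  let c : ChartedSpace (EuclideanSpace ℝ (Fin p) × TransverseModel ℓ) M :=
    { atlas := F.atlas, chartAt := e, mem_chart_source := hx, chart_mem_atlas := he }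
  exact ChartedSpace.locallyCompactSpace (EuclideanSpace ℝ (Fin p) × TransverseModel ℓ) M

/-- If `A` is a union of non-compact leaves and `closure A` contains only countably many
non-compact leaves, then `closure A` is a leaf with its leaf topology near many points of `A`. -/
theorem exists_nhdsWithin_closure_le [T2Space M] [SecondCountableTopology M] {A : Set M}
    (hA : F.Saturated A) (hnc : ∀ x ∈ A, ¬ @IsCompact M F.leafTopology (F.leaf x))
    (hcount : {L : Set M | F.IsNoncompactLeaf L ∧ L ⊆ closure A}.Countable)
    {W : Set M} (hW : IsOpen W) (hWA : (W ∩ A).Nonempty) :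
    ∃ y ∈ W ∩ A, 𝓝[closure A] y ≤ @nhds M F.leafTopology y := by
  choose B hB using F.exists_mem_inner
  obtain ⟨S, hS, hScov⟩ := TopologicalSpace.countable_cover_nhds
    fun x => (B x).isOpen_inner.mem_nhds (hB x)
  have : Countable S := hS
  let β : S → F.Box := fun x => B x
  have hβ : ∀ x, ∃ i, x ∈ (β i).inner := by
    intro x
    obtain ⟨y, hy, h⟩ := mem_iUnion₂.1 (hScov.ge (mem_univ x))
    exact ⟨⟨y, hy⟩, h⟩
  choose J hJc hJK hJ using F.exists_countable_cover_leaf β hβ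
  have : Nonempty M := ⟨hWA.some⟩
  choose! r hr using fun (L : Set M) (hL : F.IsNoncompactLeaf L) => hL.1
  have hJtot : (⋃ L ∈ {L : Set M | F.IsNoncompactLeaf L ∧ L ⊆ closure A}, J (r L)).Countable :=
    hcount.biUnion fun L _ => hJc _
  set Jt := ⋃ L ∈ {L : Set M | F.IsNoncompactLeaf L ∧ L ⊆ closure A}, J (r L)
  have : Countable Jt := hJtot
  have hJtK : ∀ j ∈ Jt, j.2 ∈ (β j.1).K := by
    intro j hj
    obtain ⟨L, -, hj⟩ := mem_iUnion₂.1 hj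
    exact hJK _ j hj
  -- The countable closed cover: finite tuples of boxes account for the compact leaves, `Jt` for the
  -- non-compact ones.
  let f : (Σ n, Fin n → S) ⊕ Jt → Set M :=
    Sum.elim (fun b => compactPart (β ∘ b.2)) fun j => (β j.1.1).slice j.1.2 '' (β j.1.1).core
  have hf : ∀ i, IsClosed (f i) := by
    rintro (b | j)
    · exact isClosed_compactPart _
    · exact (β j.1.1).isClosed_image_slice (hJtK _ j.2)
  have hfcov : ∀ x ∈ closure A, ∃ i, x ∈ f i := by
    intro x hx
    by_cases h : @IsCompact M F.leafTopology (F.leaf x)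
    · obtain ⟨n, b, h⟩ := exists_mem_compactPart β hβ h
      exact ⟨Sum.inl ⟨n, b⟩, h⟩
    · have hL : F.IsNoncompactLeaf (F.leaf x) := ⟨⟨x, rfl⟩, h⟩
      have hx' : x ∈ F.leaf (r (F.leaf x)) := hr _ hL ▸ F.mem_leaf_self x
      obtain ⟨j, hj, h⟩ := mem_iUnion₂.1 (hJ _ hx')
      exact ⟨Sum.inr ⟨j, mem_iUnion₂.2 ⟨_, ⟨hL, hA.closure x hx⟩, hj⟩⟩, h⟩
  have := F.locallyCompactSpace
  have : LocallyCompactSpace (closure A) :=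
    isClosed_closure.isClosedEmbedding_subtypeVal.locallyCompactSpace
  have hdense := dense_iUnion_interior_of_closed (X := closure A)
    (f := fun i => Subtype.val ⁻¹' f i) (fun i => (hf i).preimage continuous_subtype_val)
    (iUnion_eq_univ_iff.2 fun x => hfcov x x.2)
  obtain ⟨a, haW, haA⟩ := hWA
  obtain ⟨x, hxW, hx⟩ := hdense.inter_open_nonempty (Subtype.val ⁻¹' W)
    (hW.preimage continuous_subtype_val) ⟨⟨a, subset_closure haA⟩, haW⟩
  obtain ⟨i, hi⟩ := mem_iUnion.1 hx
  obtain ⟨V, hVf, hV, hxV⟩ := mem_interior.1 hi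
  obtain ⟨O, hO, rfl⟩ := isOpen_induced_iff.1 hV
  -- Baire only yields a point of `closure A`; it is replaced by a nearby point of `A`, whose leaf
  -- is known to be non-compact.
  obtain ⟨y, ⟨hyO, hyW⟩, hyA⟩ := mem_closure_iff.1 x.2 (O ∩ W) (hO.inter hW) ⟨hxV, hxW⟩
  have hOf : O ∩ closure A ⊆ f i := fun z hz => @hVf ⟨z, hz.2⟩ hz.1
  refine ⟨y, ⟨hyW, hyA⟩, ?_⟩
  rcases i with b | j
  · exact absurd (isCompact_leaf_of_mem_compactPart _ (hOf ⟨hyO, subset_closure hyA⟩)) (hnc y hyA)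
  · exact (β j.1.1).nhdsWithin_le (hJtK _ j.2) hO hOf hyO (subset_closure hyA)

/-! ### Isolated and proper leaves -/

theorem IsLeaf.saturated {L : Set M} (hL : F.IsLeaf L) : F.Saturated L := by
  obtain ⟨x, rfl⟩ := hL
  intro y hy
  rw [leaf_eq_of_mem hy]

theorem isIsolatedLeaf_of_nhdsWithin_le {A : Set M} (hA : F.Saturated A) {y : M} (hy : y ∈ A)
    (h : 𝓝[closure A] y ≤ @nhds M F.leafTopology y) : F.IsIsolatedLeaf A (F.leaf y) := by
  refine ⟨⟨y, rfl⟩, hA y hy, ?_⟩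
  have h1 : ∀ z ∈ F.leaf y, ∃ U, IsOpen U ∧ z ∈ U ∧ U ∩ closure A ⊆ F.leaf y := fun z hz =>
    mem_nhdsWithin.1 (hA.closure.nhdsWithin_le hz h
      (@IsOpen.mem_nhds M F.leafTopology _ _ (F.isClopen_leaf y).2 hz))
  choose! U hU hzU hUL using h1
  refine ⟨⋃ z ∈ F.leaf y, U z, isOpen_biUnion hU, Subset.antisymm ?_ ?_⟩
  · exact fun z hz => ⟨mem_biUnion hz (hzU z hz), subset_closure (hA y hy hz)⟩
  · rintro z ⟨hz, hzA⟩
    obtain ⟨w, hw, hz⟩ := mem_iUnion₂.1 hz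
    exact hUL w hw ⟨hz, hzA⟩

theorem IsLeaf.isProperLeaf_of_nhdsWithin_le {L : Set M} (hL : F.IsLeaf L)
    (h : ∀ y ∈ L, 𝓝[L] y ≤ @nhds M F.leafTopology y) : F.IsProperLeaf L := by
  refine ⟨hL, le_antisymm (induced_mono F.leafTopology_le) ?_⟩
  rw [TopologicalSpace.le_def]
  rintro _ ⟨V, hV, rfl⟩
  refine isOpen_iff_mem_nhds.2 fun y hy => ?_
  rw [mem_nhds_subtype_iff_nhdsWithin, Subtype.image_preimage_coe]
  exact inter_mem self_mem_nhdsWithin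
    (h y y.2 (@IsOpen.mem_nhds M F.leafTopology _ _ hV hy))

/-- Removing a leaf-open set from `L` leaves a leaf-compact set, which is compact, hence closed, in
the Hausdorff space `M`. -/
theorem IsLeaf.isProperLeaf_of_isCompact [T2Space M] {L : Set M} (hL : F.IsLeaf L)
    (hc : @IsCompact M F.leafTopology L) : F.IsProperLeaf L := by
  refine hL.isProperLeaf_of_nhdsWithin_le fun y _ N hN => ?_
  obtain ⟨V, hVN, hV, hyV⟩ := (@_root_.mem_nhds_iff M F.leafTopology _ _).1 hN
  have h1 : @IsCompact M F.leafTopology (L \ V) := @IsCompact.diff M F.leafTopology _ _ hc hV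
  have h2 : IsClosed (L \ V) := by
    have := @IsCompact.image M M F.leafTopology _ _ id h1 (continuous_id_of_le F.leafTopology_le)
    rw [image_id] at this
    exact this.isClosed
  filter_upwards [self_mem_nhdsWithin,
    nhdsWithin_le_nhds (h2.isOpen_compl.mem_nhds fun h => h.2 hyV)] with z hz hz'
  by_contra hzN
  exact hz' ⟨hz, fun h => hzN (hVN h)⟩

end Foliation

open Foliation in
theorem mainTheorem9 {M : Type*} [TopologicalSpace M] [T2Space M] [SecondCountableTopology M]
    {p q : ℕ} {ℓ : EuclideanSpace ℝ (Fin q) →L[ℝ] ℝ} (F : Foliation p ℓ M) :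
    (∀ A : Set M, (∃ 𝒜 : Set (Set M), (∀ L ∈ 𝒜, F.IsNoncompactLeaf L) ∧ A = ⋃₀ 𝒜) →
      ¬ {L : Set M | F.IsNoncompactLeaf L ∧ L ⊆ closure A}.Countable ∨
        A ⊆ closure (F.isolatedPart A)) ∧
    (∀ L : Set M, F.IsLeaf L → ¬ F.IsProperLeaf L →
      ¬ {L' : Set M | F.IsNoncompactLeaf L' ∧ L' ⊆ closure L}.Countable) := by
  refine ⟨?_, ?_⟩
  · rintro A ⟨𝒜, h𝒜, rfl⟩
    refine or_iff_not_imp_left.2 fun hc x hx => mem_closure_iff.2 fun W hW hxW => ?_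
    have hA : F.Saturated (⋃₀ 𝒜) := fun z ⟨L, hL, hz⟩ =>
      ((h𝒜 L hL).1.saturated z hz).trans (subset_sUnion_of_mem hL)
    have hnc : ∀ z ∈ ⋃₀ 𝒜, ¬ @IsCompact M F.leafTopology (F.leaf z) := by
      rintro z ⟨L, hL, hz⟩
      obtain ⟨⟨y, rfl⟩, hL'⟩ := h𝒜 L hL
      rwa [leaf_eq_of_mem hz]
    obtain ⟨y, ⟨hyW, hyA⟩, hy⟩ :=
      exists_nhdsWithin_closure_le hA hnc (not_not.1 hc) hW ⟨x, hxW, hx⟩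
    exact ⟨y, hyW, mem_sUnion_of_mem (F.mem_leaf_self y) (isIsolatedLeaf_of_nhdsWithin_le hA hyA hy)⟩
  · intro L hL hprop hc
    apply hprop
    have hLc : ¬ @IsCompact M F.leafTopology L := fun h => hprop (hL.isProperLeaf_of_isCompact h)
    have hA := hL.saturated
    obtain ⟨x, rfl⟩ := hL
    -- With `A` a single leaf, one good point suffices: transport reaches every other point of the
    -- leaf.
    obtain ⟨y, ⟨-, hy⟩, h⟩ := exists_nhdsWithin_closure_le hA
      (fun z hz => by rwa [leaf_eq_of_mem hz]) hc isOpen_univ ⟨x, trivial, F.mem_leaf_self x⟩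
    refine IsLeaf.isProperLeaf_of_nhdsWithin_le ⟨x, rfl⟩ fun z hz => ?_
    refine (nhdsWithin_mono _ subset_closure).trans (hA.closure.nhdsWithin_le ?_ h)
    rwa [leaf_eq_of_mem hy]
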